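/- For $\rho\in(-1,1)\setminus\{0\}$ and $\gamma\in\mathbb R$ let $F_{\rho,\gamma}$ be the distribution function of $$\rho\left[\left(Z_1+\frac{\gamma}{\sqrt{2(1-\rho)}}\right)^2-\left(Z_2+\frac{\gamma}{\sqrt{2(1+\rho)}}\right)^2\right],$$ where $Z_1,Z_2$ are independent standard normal variables (the weak-strong asymptotic laws), and for $\delta\in\mathbb R$ let $G_\delta$ be the distribution function of $\mathcal N(\delta^2,(2\delta)^2)$, read as the point mass at $0$ if $\delta=0$ (the weak-weak asymptotic laws). The envelope of a family $\{F_h:h\in\mathcal H\}$ of distribution functions on $\mathbb R$ is the function $\bar F$ with $\bar F(x)=\bar F^*(x)$ if $\bar F^*:=\sup_{h\in\mathcal H}F_h$ is continuous at $x$, and $\bar F(x)=\lim_{y\to x^+}\bar F^*(y)$ otherwise. Let $\bar F_\rho$ be the envelope of $\{F_{\rho,\gamma}:\gamma\in\mathbb R\}$ and $\bar G$ the envelope of $\{G_\delta:\delta\in\mathbb R\}$. Then $\bar F_\rho$ $(0<|\rho|<1)$ and $\bar G$ are distribution functions of probability measures on $\mathbb R$; $\bar G$ is the distribution function of the equal-probability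 mixture of $-\chi^2_1$ (the law of $-Z^2$ with $Z$ standard normal) and the point mass at $0$; and $\bar F_\rho$ converges weakly to $\bar G$ as $\rho\to0$. Hence the family extended by $\bar F_0:=\bar G$ is continuous at $\rho=0$ in the topology of weak convergence. -/

import Mathlib

open MeasureTheory ProbabilityTheory Filter Topology

noncomputable section

/-- The pointwise supremum `F*(x) = sup_h F_h(x)` of a family of functions on the real line. -/
def pointwiseSup {ι : Type*} (F : ι → ℝ → ℝ) (x : ℝ) : ℝ := ⨆ h, F h x

open Classical in
/-- The envelope of a family of distribution functions: the pointwise supremum where the latter is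
continuous, and the right limit of the pointwise supremum where it is not. -/
def envelope {ι : Type*} (F : ι → ℝ → ℝ) (x : ℝ) : ℝ :=
  if ContinuousAt (pointwiseSup F) x then pointwiseSup F x
  else Function.rightLim (pointwiseSup F) x

/-- The weak-strong asymptotic law with parameters `ρ` and `γ`: the law of
`ρ * ((Z₁ + γ / √(2 (1 - ρ)))² - (Z₂ + γ / √(2 (1 + ρ)))²)`
for independent standard normal variables `Z₁`, `Z₂`. -/
def weakStrongLaw (ρ γ : ℝ) : Measure ℝ :=
  ((gaussianReal 0 1).prod (gaussianReal 0 1)).map fun z : ℝ × ℝ =>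
    ρ * ((z.1 + γ / √(2 * (1 - ρ))) ^ 2 - (z.2 + γ / √(2 * (1 + ρ))) ^ 2)

instance (ρ γ : ℝ) : IsProbabilityMeasure (weakStrongLaw ρ γ) :=
  Measure.isProbabilityMeasure_map (Measurable.aemeasurable (by fun_prop))

/-- The weak-weak asymptotic law with parameter `δ`: the normal law with mean `δ²` and variance
`(2 δ)²` (the point mass at `0` if `δ = 0`). -/
def weakWeakLaw (δ : ℝ) : Measure ℝ :=
  gaussianReal (δ ^ 2) (Real.toNNReal ((2 * δ) ^ 2))

instance (δ : ℝ) : IsProbabilityMeasure (weakWeakLaw δ) :=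
  inferInstanceAs (IsProbabilityMeasure (gaussianReal _ _))

/-- The weak-strong envelope: the envelope over the local parameter `γ`, for fixed `ρ`. -/
def weakStrongEnvelope (ρ : ℝ) : ℝ → ℝ :=
  envelope fun (γ : ℝ) (x : ℝ) => cdf (weakStrongLaw ρ γ) x

/-- The weak-weak envelope: the envelope over the local parameter `δ`. -/
def weakWeakEnvelope : ℝ → ℝ :=
  envelope fun (δ : ℝ) (x : ℝ) => cdf (weakWeakLaw δ) x

/-- The chi-square law with one degree of freedom: the law of `Z²` for a standard normal `Z`. -/
def chiSquareOne : Measure ℝ := (gaussianReal 0 1).map fun z => z ^ 2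

instance : IsProbabilityMeasure chiSquareOne :=
  Measure.isProbabilityMeasure_map (Measurable.aemeasurable (by fun_prop))

/-- The equal-probability mixture of the law of the negative of a chi-square variable with one
degree of freedom and the point mass at `0`. -/
def negChiSquareMixture : Measure ℝ :=
  (2⁻¹ : ENNReal) • (chiSquareOne.map fun y => -y) + (2⁻¹ : ENNReal) • Measure.dirac 0

end

open MeasureTheory ProbabilityTheory Filter Topology Set

noncomputable section

namespace WeakIdentificationEnvelope

/-! ### Convergence of distribution functions implies weak convergence -/

/-! With `δ = ργ / √(1 - ρ²)`, the weak-strong variable is `ρ (Z₁² - Z₂²) + (δ² + 2δN)` with `N`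
standard normal (`weakStrong_decomposition`). The bracket has the weak-weak law, and the remainder
is small in probability as `ρ → 0`, uniformly in `γ`. Since `γ ↦ δ` is onto, the two suprema agree
up to a shift `ε` and an error `squareDiffTail (ε / |ρ|)` (`weakStrongSup_le`, `weakWeakSup_le`).
The weak-weak supremum is explicit (`weakWeakSup_eq_cdf`). The sandwich then yields both the limits
at `±∞` for fixed `ρ` and the convergence as `ρ → 0`. -/

theorem measureReal_Ioc_eq_cdf_sub (μ : Measure ℝ) [IsProbabilityMeasure μ] {a b : ℝ}
    (hab : a ≤ b) : μ.real (Ioc a b) = cdf μ b - cdf μ a := by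
  rw [cdf_eq_real, cdf_eq_real, ← Iic_sdiff_Iic,
    measureReal_sdiff (Iic_subset_Iic.2 hab) measurableSet_Iic]

theorem exists_continuousAt_mem_Ioo {f : ℝ → ℝ} (hf : Monotone f) {a b : ℝ} (hab : a < b) :
    ∃ c ∈ Ioo a b, ContinuousAt f c := by
  have hd : Dense {x | ¬ ContinuousAt f x}ᶜ := hf.countable_not_continuousAt.dense_compl ℝ
  obtain ⟨c, hc, hc'⟩ := hd.exists_mem_open isOpen_Ioo (nonempty_Ioo.2 hab)
  exact ⟨c, hc', not_not.1 hc⟩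

/-- Pointwise convergence of distribution functions at the continuity points of the limiting
distribution function implies weak convergence. -/
theorem tendsto_probabilityMeasure_of_tendsto_cdf {ι : Type*} {l : Filter ι}
    [l.IsCountablyGenerated] {μ : ι → ProbabilityMeasure ℝ} {ν : ProbabilityMeasure ℝ}
    (h : ∀ x, ContinuousAt (cdf (ν : Measure ℝ)) x →
      Tendsto (fun i => cdf (μ i : Measure ℝ) x) l (𝓝 (cdf (ν : Measure ℝ) x))) :
    Tendsto μ l (𝓝 ν) := by
  have hmono : Monotone (cdf (ν : Measure ℝ)) := monotone_cdf _
  -- Continuity endpoints survive intersection, and their density makes these intervals a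
  -- neighbourhood base.
  refine IsPiSystem.tendsto_probabilityMeasure_of_tendsto_of_mem
    (S := {s | ∃ a b, a < b ∧ ContinuousAt (cdf (ν : Measure ℝ)) a ∧
      ContinuousAt (cdf (ν : Measure ℝ)) b ∧ s = Ioc a b}) ?_ ?_ ?_ ?_
  · rintro _ ⟨a, b, -, ha, hb, rfl⟩ _ ⟨c, d, -, hc, hd, rfl⟩ hne
    rw [Ioc_inter_Ioc] at hne ⊢
    refine ⟨_, _, nonempty_Ioc.1 hne, ?_, ?_, rfl⟩
    · rcases max_choice a c with h | h <;> rw [h] <;> assumption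
    · rcases min_choice b d with h | h <;> rw [h] <;> assumption
  · rintro _ ⟨a, b, -, -, -, rfl⟩
    exact measurableSet_Ioc
  · intro u hu x hx
    obtain ⟨p, q, hpq, hsub⟩ := mem_nhds_iff_exists_Ioo_subset.1 (hu.mem_nhds hx)
    obtain ⟨a, ha, hac⟩ := exists_continuousAt_mem_Ioo hmono hpq.1
    obtain ⟨b, hb, hbc⟩ := exists_continuousAt_mem_Ioo hmono hpq.2
    refine ⟨Ioc a b, ⟨a, b, ha.2.trans hb.1, hac, hbc, rfl⟩, Ioc_mem_nhds ha.2 hb.1, ?_⟩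
    exact fun y hy => hsub ⟨ha.1.trans hy.1, hy.2.trans_lt hb.2⟩
  · rintro _ ⟨a, b, hab, ha, hb, rfl⟩
    rw [← NNReal.tendsto_coe]
    have key : ∀ m : ProbabilityMeasure ℝ,
        ((m (Ioc a b) : NNReal) : ℝ) = cdf (m : Measure ℝ) b - cdf (m : Measure ℝ) a :=
      fun m => measureReal_Ioc_eq_cdf_sub (m : Measure ℝ) hab.le
    simp only [key]
    exact (h b hb).sub (h a ha)

/-! ### Envelopes -/

/-- At a continuity point the right limit is the value, so the case split disappears. -/
theorem envelope_eq_rightLim {ι : Type*} (F : ι → ℝ → ℝ) :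
    envelope F = Function.rightLim (pointwiseSup F) := by
  ext x
  unfold envelope
  split_ifs with h
  · exact h.continuousWithinAt.rightLim_eq.symm
  · rfl

section CdfFamily

variable {ι : Type*} (μ : ι → Measure ℝ)

theorem bddAbove_range_cdf (x : ℝ) : BddAbove (range fun h => cdf (μ h) x) :=
  ⟨1, by rintro _ ⟨h, rfl⟩; exact cdf_le_one _ _⟩

theorem cdf_le_pointwiseSup (h : ι) (x : ℝ) :
    cdf (μ h) x ≤ pointwiseSup (fun h x => cdf (μ h) x) x :=
  le_ciSup (bddAbove_range_cdf μ x) h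

theorem pointwiseSup_cdf_le_one [Nonempty ι] (x : ℝ) :
    pointwiseSup (fun h x => cdf (μ h) x) x ≤ 1 :=
  ciSup_le fun _ => cdf_le_one _ _

theorem monotone_pointwiseSup_cdf [Nonempty ι] :
    Monotone (pointwiseSup fun h x => cdf (μ h) x) := fun _ y hxy =>
  ciSup_le fun h => (monotone_cdf (μ h) hxy).trans (cdf_le_pointwiseSup μ h y)

end CdfFamily

/-! ### Coupling -/

/-- The distribution functions of two random variables on the same space differ by at most a shift
plus the probability that the variables are further apart than the shift. -/
theorem cdf_map_le_cdf_map_add {Ω : Type*} [MeasurableSpace Ω] (m : Measure Ω)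
    [IsProbabilityMeasure m] {X U : Ω → ℝ} (hX : Measurable X) (hU : Measurable U) (x ε : ℝ) :
    cdf (m.map X) x ≤ cdf (m.map U) (x + ε) + m.real {ω | ε < |X ω - U ω|} := by
  have := Measure.isProbabilityMeasure_map (μ := m) hX.aemeasurable
  have := Measure.isProbabilityMeasure_map (μ := m) hU.aemeasurable
  rw [cdf_eq_real, cdf_eq_real, map_measureReal_apply hX measurableSet_Iic,
    map_measureReal_apply hU measurableSet_Iic]
  refine (measureReal_mono fun ω hω => ?_).trans (measureReal_union_le _ _)
  simp only [mem_preimage, mem_Iic, mem_union, mem_ofPred_eq] at hω ⊢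
  by_contra! hc
  linarith [neg_abs_le (X ω - U ω)]

/-- A pair of independent standard normal variables. -/
abbrev stdGaussianPair : Measure (ℝ × ℝ) := (gaussianReal 0 1).prod (gaussianReal 0 1)

/-- The probability that `|Z₁² - Z₂²|` exceeds `t`. -/
def squareDiffTail (t : ℝ) : ℝ := stdGaussianPair.real {z | t < |z.1 ^ 2 - z.2 ^ 2|}

theorem tendsto_squareDiffTail : Tendsto squareDiffTail atTop (𝓝 0) := by
  have hm : Measurable fun z : ℝ × ℝ => |z.1 ^ 2 - z.2 ^ 2| := by fun_prop
  have := Measure.isProbabilityMeasure_map (μ := stdGaussianPair) hm.aemeasurable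
  have h : squareDiffTail = fun t =>
      1 - cdf (stdGaussianPair.map fun z : ℝ × ℝ => |z.1 ^ 2 - z.2 ^ 2|) t := by
    ext t
    rw [cdf_eq_real, map_measureReal_apply hm measurableSet_Iic,
      ← probReal_compl_eq_one_sub (hm measurableSet_Iic)]
    unfold squareDiffTail
    congr 1
    ext z
    simp
  rw [h]
  simpa using (tendsto_cdf_atTop _).const_sub 1

theorem weakWeakLaw_eq_map (δ : ℝ) :
    weakWeakLaw δ = (gaussianReal 0 1).map fun z => δ ^ 2 + 2 * δ * z := by
  have h : (fun z : ℝ => δ ^ 2 + 2 * δ * z) = (fun z => δ ^ 2 + z) ∘ fun z => 2 * δ * z := rfl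
  rw [h, ← Measure.map_map (by fun_prop) (by fun_prop), gaussianReal_map_const_mul,
    gaussianReal_map_const_add]
  unfold weakWeakLaw
  congr 1
  · simp
  · ext
    simp [Real.coe_toNNReal _ (sq_nonneg (2 * δ))]

theorem map_linearCombination_stdGaussianPair (a b : ℝ) (h : a ^ 2 + b ^ 2 = 1) :
    stdGaussianPair.map (fun z : ℝ × ℝ => a * z.1 + b * z.2) = gaussianReal 0 1 := by
  have hind : IndepFun (fun z : ℝ × ℝ => a * z.1) (fun z : ℝ × ℝ => b * z.2) stdGaussianPair :=
    indepFun_prod (X := fun x => a * x) (Y := fun x => b * x) (by fun_prop) (by fun_prop)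
  have h1 : stdGaussianPair.map (fun z : ℝ × ℝ => a * z.1) =
      gaussianReal (a * 0) (.mk (a ^ 2) (sq_nonneg _) * 1) := by
    rw [← gaussianReal_map_const_mul, ← (measurePreserving_fst (μ := gaussianReal 0 1)
      (ν := gaussianReal 0 1)).map_eq, Measure.map_map (by fun_prop) (by fun_prop)]
    rfl
  have h2 : stdGaussianPair.map (fun z : ℝ × ℝ => b * z.2) =
      gaussianReal (b * 0) (.mk (b ^ 2) (sq_nonneg _) * 1) := by
    rw [← gaussianReal_map_const_mul, ← (measurePreserving_snd (μ := gaussianReal 0 1)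
      (ν := gaussianReal 0 1)).map_eq, Measure.map_map (by fun_prop) (by fun_prop)]
    rfl
  refine (gaussianReal_add_gaussianReal_of_indepFun hind h1 h2).trans ?_
  congr 1
  · simp
  · ext
    simpa using h

/-- The standard normal variable that drives the linear part of the weak-strong limit. -/
def drivingNormal (ρ : ℝ) (z : ℝ × ℝ) : ℝ := √((1 + ρ) / 2) * z.1 + -√((1 - ρ) / 2) * z.2

@[fun_prop]
theorem measurable_drivingNormal (ρ : ℝ) : Measurable (drivingNormal ρ) := by
  unfold drivingNormal
  fun_prop

theorem map_drivingNormal {ρ : ℝ} (hρ : |ρ| < 1) :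
    stdGaussianPair.map (drivingNormal ρ) = gaussianReal 0 1 := by
  have := abs_lt.1 hρ
  refine map_linearCombination_stdGaussianPair _ _ ?_
  rw [neg_sq, Real.sq_sqrt (by linarith), Real.sq_sqrt (by linarith)]
  ring

theorem weakWeakLaw_eq_map_drivingNormal {ρ : ℝ} (hρ : |ρ| < 1) (δ : ℝ) :
    weakWeakLaw δ = stdGaussianPair.map fun z => δ ^ 2 + 2 * δ * drivingNormal ρ z := by
  rw [weakWeakLaw_eq_map, ← map_drivingNormal hρ, Measure.map_map (by fun_prop) (by fun_prop)]
  rfl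

theorem weakStrong_decomposition {ρ : ℝ} (hρ : |ρ| < 1) (γ : ℝ) (z : ℝ × ℝ) :
    ρ * ((z.1 + γ / √(2 * (1 - ρ))) ^ 2 - (z.2 + γ / √(2 * (1 + ρ))) ^ 2) =
      ρ * (z.1 ^ 2 - z.2 ^ 2) + ((ρ * γ / √(1 - ρ ^ 2)) ^ 2 +
        2 * (ρ * γ / √(1 - ρ ^ 2)) * drivingNormal ρ z) := by
  obtain ⟨h1, h2⟩ := abs_lt.1 hρ
  have hp : 0 < 1 + ρ := by linarith
  have hm : 0 < 1 - ρ := by linarith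
  have e : 1 - ρ ^ 2 = (1 + ρ) * (1 - ρ) := by ring
  unfold drivingNormal
  rw [e, Real.sqrt_mul hp.le, Real.sqrt_mul zero_le_two, Real.sqrt_mul zero_le_two,
    Real.sqrt_div hp.le, Real.sqrt_div hm.le]
  have ht := Real.sq_sqrt (zero_le_two (α := ℝ))
  have ht0 : 0 < √(2 : ℝ) := by positivity
  have hp' := Real.sq_sqrt hp.le
  have hp0 := Real.sqrt_pos.2 hp
  have hm' := Real.sq_sqrt hm.le
  have hm0 := Real.sqrt_pos.2 hm
  generalize √(2 : ℝ) = t at *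
  generalize √(1 + ρ) = p at *
  generalize √(1 - ρ) = q at *
  -- Eliminating `ρ` leaves a rational identity in the three square roots.
  have hr : ρ = (p ^ 2 - q ^ 2) / t ^ 2 := by rw [ht, hp', hm']; ring
  rw [hr]
  field_simp
  ring

theorem lt_abs_mul_iff {ρ : ℝ} (hρ : 0 < |ρ|) (ε s : ℝ) :
    ε < |ρ * s| ↔ ε / |ρ| < |s| := by
  rw [abs_mul, div_lt_iff₀ hρ, mul_comm]

theorem cdf_weakStrongLaw_le {ρ : ℝ} (h0 : 0 < |ρ|) (h1 : |ρ| < 1) (γ x ε : ℝ) :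
    cdf (weakStrongLaw ρ γ) x ≤
      cdf (weakWeakLaw (ρ * γ / √(1 - ρ ^ 2))) (x + ε) + squareDiffTail (ε / |ρ|) := by
  rw [weakWeakLaw_eq_map_drivingNormal h1]
  simp only [weakStrongLaw, squareDiffTail, ← lt_abs_mul_iff h0]
  refine (cdf_map_le_cdf_map_add _ (U := fun z => (ρ * γ / √(1 - ρ ^ 2)) ^ 2 +
    2 * (ρ * γ / √(1 - ρ ^ 2)) * drivingNormal ρ z) (by fun_prop) (by fun_prop) x ε).trans_eq ?_
  simp only [weakStrong_decomposition h1, add_sub_cancel_right]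

theorem cdf_weakWeakLaw_le {ρ : ℝ} (h0 : 0 < |ρ|) (h1 : |ρ| < 1) (γ x ε : ℝ) :
    cdf (weakWeakLaw (ρ * γ / √(1 - ρ ^ 2))) x ≤
      cdf (weakStrongLaw ρ γ) (x + ε) + squareDiffTail (ε / |ρ|) := by
  rw [weakWeakLaw_eq_map_drivingNormal h1]
  simp only [weakStrongLaw, squareDiffTail, ← lt_abs_mul_iff h0]
  refine (cdf_map_le_cdf_map_add _ (U := fun z : ℝ × ℝ =>
    ρ * ((z.1 + γ / √(2 * (1 - ρ))) ^ 2 - (z.2 + γ / √(2 * (1 + ρ))) ^ 2))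
    (by fun_prop) (by fun_prop) x ε).trans_eq ?_
  simp only [weakStrong_decomposition h1, sub_add_cancel_right, abs_neg]

/-- The pointwise supremum of the weak-strong distribution functions. -/
abbrev weakStrongSup (ρ : ℝ) : ℝ → ℝ := pointwiseSup fun γ x => cdf (weakStrongLaw ρ γ) x

/-- The pointwise supremum of the weak-weak distribution functions. -/
abbrev weakWeakSup : ℝ → ℝ := pointwiseSup fun δ x => cdf (weakWeakLaw δ) x

theorem weakStrongSup_le {ρ : ℝ} (h0 : 0 < |ρ|) (h1 : |ρ| < 1) (x ε : ℝ) :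
    weakStrongSup ρ x ≤ weakWeakSup (x + ε) + squareDiffTail (ε / |ρ|) :=
  ciSup_le fun γ => (cdf_weakStrongLaw_le h0 h1 γ x ε).trans
    (add_le_add_left (cdf_le_pointwiseSup weakWeakLaw _ _) _)

theorem weakWeakSup_le {ρ : ℝ} (h0 : 0 < |ρ|) (h1 : |ρ| < 1) (x ε : ℝ) :
    weakWeakSup x ≤ weakStrongSup ρ (x + ε) + squareDiffTail (ε / |ρ|) := by
  refine ciSup_le fun δ => ?_
  have hρ : ρ ≠ 0 := abs_pos.1 h0
  have hs : √(1 - ρ ^ 2) ≠ 0 := (Real.sqrt_pos.2 (by linarith [(sq_lt_one_iff_abs_lt_one ρ).2 h1])).ne'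
  -- The preimage of `δ` under the reparametrization; this needs `ρ ≠ 0`.
  have h := cdf_weakWeakLaw_le h0 h1 (δ * √(1 - ρ ^ 2) / ρ) x ε
  rw [show ρ * (δ * √(1 - ρ ^ 2) / ρ) / √(1 - ρ ^ 2) = δ by field_simp] at h
  exact h.trans (add_le_add_left (cdf_le_pointwiseSup (weakStrongLaw ρ) _ _) _)

/-! ### The weak-weak envelope -/

theorem gaussian_real_Ici_eq_Iic (s : ℝ) :
    (gaussianReal 0 1).real (Ici s) = (gaussianReal 0 1).real (Iic (-s)) := by
  have h := gaussianReal_map_neg (μ := 0) (v := 1)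
  rw [neg_zero] at h
  conv_lhs => rw [← h]
  rw [map_measureReal_apply (by fun_prop) measurableSet_Ici]
  congr 1
  ext z
  simp

instance : IsProbabilityMeasure negChiSquareMixture := by
  have : IsProbabilityMeasure (chiSquareOne.map fun y => -y) :=
    Measure.isProbabilityMeasure_map (by fun_prop)
  constructor
  simp [negChiSquareMixture, ENNReal.inv_two_add_inv_two]

theorem cdf_weakWeakLaw (δ x : ℝ) :
    cdf (weakWeakLaw δ) x = (gaussianReal 0 1).real {z | δ ^ 2 + 2 * δ * z ≤ x} := by
  rw [cdf_eq_real, weakWeakLaw_eq_map, map_measureReal_apply (by fun_prop) measurableSet_Iic]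
  rfl

theorem cdf_negChiSquareMixture (x : ℝ) :
    cdf negChiSquareMixture x =
      2⁻¹ * (gaussianReal 0 1).real {z | -z ^ 2 ≤ x} + 2⁻¹ * (Measure.dirac (0 : ℝ)).real (Iic x) := by
  rw [cdf_eq_real, negChiSquareMixture, measureReal_add_apply
    (by simp [ENNReal.mul_eq_top]) (ENNReal.mul_ne_top (by simp) (measure_ne_top _ _)),
    measureReal_ennreal_smul_apply,
    measureReal_ennreal_smul_apply, chiSquareOne, Measure.map_map (by fun_prop) (by fun_prop),
    map_measureReal_apply (by fun_prop) measurableSet_Iic]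
  simp
  rfl

theorem weakWeakSup_of_nonneg {x : ℝ} (hx : 0 ≤ x) : weakWeakSup x = 1 := by
  refine le_antisymm (pointwiseSup_cdf_le_one _ _) (le_trans ?_ (cdf_le_pointwiseSup weakWeakLaw 0 x))
  rw [cdf_weakWeakLaw]
  simp [hx]

/-- For `δ > 0` the event is `Z ≤ -(δ² + s²) / (2δ)`, and by AM-GM this threshold is at most `-s`,
with equality at `δ = s`. Negative `δ` is symmetric. -/
theorem weakWeakSup_neg_sq {s : ℝ} (hs : 0 < s) :
    weakWeakSup (-s ^ 2) = (gaussianReal 0 1).real (Iic (-s)) := by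
  refine le_antisymm (ciSup_le fun δ => ?_) (le_trans ?_ (cdf_le_pointwiseSup weakWeakLaw s _))
  · beta_reduce
    rw [cdf_weakWeakLaw]
    rcases le_total 0 δ with hδ | hδ
    · refine measureReal_mono fun z hz => ?_
      simp only [mem_ofPred_eq, mem_Iic] at hz ⊢
      by_contra! hc
      rcases hδ.eq_or_lt with rfl | hδ
      · nlinarith
      · nlinarith [sq_nonneg (δ - s), mul_pos hδ (by linarith : 0 < z + s)]
    · rw [← gaussian_real_Ici_eq_Iic]
      refine measureReal_mono fun z hz => ?_
      simp only [mem_ofPred_eq, mem_Ici] at hz ⊢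
      by_contra! hc
      rcases hδ.eq_or_lt with rfl | hδ
      · nlinarith
      · nlinarith [sq_nonneg (δ + s), mul_pos (neg_pos.2 hδ) (by linarith : 0 < s - z)]
  · rw [cdf_weakWeakLaw]
    refine measureReal_mono fun z hz => ?_
    simp only [mem_ofPred_eq, mem_Iic] at hz ⊢
    nlinarith

/-- Below `0` the chi-square part has two equal normal tails, and the weight `1/2` keeps one. From
`0` on, the value `1` is attained at `δ = 0`. -/
theorem weakWeakSup_eq_cdf (x : ℝ) : weakWeakSup x = cdf negChiSquareMixture x := by
  rw [cdf_negChiSquareMixture]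
  rcases le_or_gt 0 x with hx | hx
  · rw [weakWeakSup_of_nonneg hx]
    have h : {z : ℝ | -z ^ 2 ≤ x} = univ := eq_univ_of_forall fun z => by
      simp only [mem_ofPred_eq]; nlinarith [sq_nonneg z]
    rw [h]
    simp [measureReal_def, hx]
    norm_num
  · obtain ⟨s, hs, rfl⟩ : ∃ s : ℝ, 0 < s ∧ x = -s ^ 2 :=
      ⟨√(-x), Real.sqrt_pos.2 (by linarith), by rw [Real.sq_sqrt (by linarith)]; ring⟩
    have h : {z : ℝ | -z ^ 2 ≤ -s ^ 2} = Iic (-s) ∪ Ici s := by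
      ext z
      simp only [mem_ofPred_eq, mem_union, mem_Iic, mem_Ici, neg_le_neg_iff, sq_le_sq, abs_of_pos hs,
        le_abs]
      constructor <;> rintro (h | h)
      · exact Or.inr h
      · exact Or.inl (by linarith)
      · exact Or.inr (by linarith)
      · exact Or.inl h
    rw [weakWeakSup_neg_sq hs, h, measureReal_union _ measurableSet_Ici, gaussian_real_Ici_eq_Iic]
    · have h0 : (0 : ℝ) ∉ Iic (-s ^ 2) := not_le.2 hx
      simp [measureReal_def, -mem_Iic, h0]
      ring
    · exact Set.disjoint_left.2 fun z hz hz' => by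
        simp only [mem_Iic, mem_Ici] at hz hz'
        linarith

theorem weakWeakEnvelope_eq_cdf (x : ℝ) : weakWeakEnvelope x = cdf negChiSquareMixture x := by
  have h : weakWeakSup = cdf negChiSquareMixture := funext weakWeakSup_eq_cdf
  unfold weakWeakEnvelope
  rw [envelope_eq_rightLim]
  change Function.rightLim weakWeakSup x = _
  rw [h, StieltjesFunction.rightLim_eq]

/-! ### The weak-strong envelope -/

theorem weakStrongEnvelope_eq_rightLim (ρ : ℝ) :
    weakStrongEnvelope ρ = Function.rightLim (weakStrongSup ρ) :=
  envelope_eq_rightLim _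

theorem monotone_weakStrongSup (ρ : ℝ) : Monotone (weakStrongSup ρ) :=
  monotone_pointwiseSup_cdf _

/-- One `ε` dominates the right limit, the other pays for the coupling. -/
theorem weakStrongEnvelope_le {ρ : ℝ} (h0 : 0 < |ρ|) (h1 : |ρ| < 1) (x : ℝ) {ε : ℝ} (hε : 0 < ε) :
    weakStrongEnvelope ρ x ≤
      cdf negChiSquareMixture (x + 2 * ε) + squareDiffTail (ε / |ρ|) := by
  rw [weakStrongEnvelope_eq_rightLim, ← weakWeakSup_eq_cdf]
  refine ((monotone_weakStrongSup ρ).rightLim_le (lt_add_of_pos_right x hε)).trans ?_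
  rw [show x + 2 * ε = x + ε + ε by ring]
  exact weakStrongSup_le h0 h1 _ _

theorem le_weakStrongEnvelope {ρ : ℝ} (h0 : 0 < |ρ|) (h1 : |ρ| < 1) (x ε : ℝ) :
    cdf negChiSquareMixture (x - ε) - squareDiffTail (ε / |ρ|) ≤ weakStrongEnvelope ρ x := by
  rw [weakStrongEnvelope_eq_rightLim, ← weakWeakSup_eq_cdf]
  refine le_trans ?_ ((monotone_weakStrongSup ρ).le_rightLim le_rfl)
  have h := weakWeakSup_le h0 h1 (x - ε) ε
  rw [sub_add_cancel] at h
  linarith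

theorem weakStrongEnvelope_nonneg (ρ x : ℝ) : 0 ≤ weakStrongEnvelope ρ x := by
  rw [weakStrongEnvelope_eq_rightLim]
  exact ((cdf_nonneg _ x).trans (cdf_le_pointwiseSup (weakStrongLaw ρ) 0 x)).trans
    ((monotone_weakStrongSup ρ).le_rightLim le_rfl)

theorem weakStrongEnvelope_le_one (ρ x : ℝ) : weakStrongEnvelope ρ x ≤ 1 := by
  rw [weakStrongEnvelope_eq_rightLim]
  exact ((monotone_weakStrongSup ρ).rightLim_le (lt_add_one x)).trans (pointwiseSup_cdf_le_one _ _)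

/-- With `ρ` fixed the tail error vanishes only if `ε → ∞`, so `ε` grows in proportion to `|x|`,
slowly enough that the shifted point `x / 2` still diverges. -/
theorem tendsto_weakStrongEnvelope_atBot {ρ : ℝ} (h0 : 0 < |ρ|) (h1 : |ρ| < 1) :
    Tendsto (weakStrongEnvelope ρ) atBot (𝓝 0) := by
  have hlim : Tendsto (fun x : ℝ => cdf negChiSquareMixture (x / 2) +
      squareDiffTail (-x / (4 * |ρ|))) atBot (𝓝 (0 + 0)) :=
    ((tendsto_cdf_atBot _).comp (tendsto_id.atBot_div_const zero_lt_two)).add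
      (tendsto_squareDiffTail.comp (tendsto_neg_atBot_atTop.atTop_div_const (by positivity)))
  rw [add_zero] at hlim
  refine tendsto_of_tendsto_of_tendsto_of_le_of_le' tendsto_const_nhds hlim
    (Eventually.of_forall (weakStrongEnvelope_nonneg ρ)) ?_
  filter_upwards [eventually_lt_atBot 0] with x hx
  refine (weakStrongEnvelope_le h0 h1 x (ε := -x / 4) (by linarith)).trans_eq ?_
  rw [div_div, show x + 2 * (-x / 4) = x / 2 by ring]

theorem tendsto_weakStrongEnvelope_atTop {ρ : ℝ} (h0 : 0 < |ρ|) (h1 : |ρ| < 1) :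
    Tendsto (weakStrongEnvelope ρ) atTop (𝓝 1) := by
  have hlim : Tendsto (fun x : ℝ => cdf negChiSquareMixture (x / 2) -
      squareDiffTail (x / (2 * |ρ|))) atTop (𝓝 (1 - 0)) :=
    ((tendsto_cdf_atTop _).comp (tendsto_id.atTop_div_const zero_lt_two)).sub
      (tendsto_squareDiffTail.comp (tendsto_id.atTop_div_const (by positivity)))
  rw [sub_zero] at hlim
  refine tendsto_of_tendsto_of_tendsto_of_le_of_le hlim tendsto_const_nhds
    (fun x => ?_) (weakStrongEnvelope_le_one ρ)
  have h := le_weakStrongEnvelope h0 h1 x (x / 2)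
  rwa [div_div, sub_half] at h

/-- The weak-strong envelope is the distribution function of a probability measure. -/
theorem exists_cdf_eq_weakStrongEnvelope {ρ : ℝ} (h0 : 0 < |ρ|) (h1 : |ρ| < 1) :
    ∃ P : ProbabilityMeasure ℝ, ∀ x, cdf (P : Measure ℝ) x = weakStrongEnvelope ρ x := by
  let f : StieltjesFunction ℝ := (monotone_weakStrongSup ρ).stieltjesFunction
  have hf : ⇑f = weakStrongEnvelope ρ := (weakStrongEnvelope_eq_rightLim ρ).symm
  have hbot : Tendsto f atBot (𝓝 0) := hf ▸ tendsto_weakStrongEnvelope_atBot h0 h1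
  have htop : Tendsto f atTop (𝓝 1) := hf ▸ tendsto_weakStrongEnvelope_atTop h0 h1
  refine ⟨⟨f.measure, f.isProbabilityMeasure hbot htop⟩, fun x => ?_⟩
  change cdf f.measure x = _
  rw [cdf_measure_stieltjesFunction f hbot htop, hf]

theorem tendsto_squareDiffTail_div_abs {ε : ℝ} (hε : 0 < ε) :
    Tendsto (fun ρ : ℝ => squareDiffTail (ε / |ρ|)) (𝓝[≠] 0) (𝓝 0) := by
  have h : Tendsto (fun ρ : ℝ => |ρ|⁻¹) (𝓝[≠] 0) atTop :=
    tendsto_inv_nhdsGT_zero.comp (tendsto_abs_nhdsNE_zero)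
  exact tendsto_squareDiffTail.comp (h.const_mul_atTop hε)

theorem eventually_abs_pos_and_lt_one : ∀ᶠ ρ : ℝ in 𝓝[≠] 0, 0 < |ρ| ∧ |ρ| < 1 := by
  have h : ∀ᶠ ρ : ℝ in 𝓝[≠] 0, |ρ| < 1 :=
    nhdsWithin_le_nhds ((continuous_abs.tendsto' 0 0 abs_zero).eventually_lt_const zero_lt_one)
  filter_upwards [self_mem_nhdsWithin, h] with ρ hρ hρ'
  exact ⟨abs_pos.2 hρ, hρ'⟩

/-- Continuity at `x` fixes `ε` first; then `ρ → 0` removes the tail error. -/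
theorem tendsto_weakStrongEnvelope {x : ℝ} (hx : ContinuousAt (cdf negChiSquareMixture) x) :
    Tendsto (fun ρ => weakStrongEnvelope ρ x) (𝓝[≠] 0) (𝓝 (cdf negChiSquareMixture x)) := by
  set C := cdf negChiSquareMixture
  rw [tendsto_order]
  constructor
  · intro a ha
    have hc : Tendsto (fun ε : ℝ => C (x - ε)) (𝓝[>] 0) (𝓝 (C x)) :=
      hx.tendsto.comp (((continuous_sub_left x).tendsto' 0 x (sub_zero x)).mono_left
        nhdsWithin_le_nhds)
    obtain ⟨ε, hε, hpos⟩ := ((hc.eventually_const_lt ha).and self_mem_nhdsWithin).exists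
    filter_upwards [eventually_abs_pos_and_lt_one, (tendsto_squareDiffTail_div_abs
      hpos).eventually_lt_const (sub_pos.2 hε)] with ρ hρ ht
    linarith [le_weakStrongEnvelope hρ.1 hρ.2 x ε]
  · intro a ha
    have hc : Tendsto (fun ε : ℝ => C (x + 2 * ε)) (𝓝[>] 0) (𝓝 (C x)) :=
      hx.tendsto.comp (((by fun_prop : Continuous fun ε : ℝ => x + 2 * ε).tendsto' 0 x
        (by simp)).mono_left nhdsWithin_le_nhds)
    obtain ⟨ε, hε, hpos⟩ := ((hc.eventually_lt_const ha).and self_mem_nhdsWithin).exists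
    filter_upwards [eventually_abs_pos_and_lt_one, (tendsto_squareDiffTail_div_abs
      hpos).eventually_lt_const (sub_pos.2 hε)] with ρ hρ ht
    linarith [weakStrongEnvelope_le hρ.1 hρ.2 x hpos]

end WeakIdentificationEnvelope

end

theorem mainTheorem4 :
    ∃ (P : ℝ → ProbabilityMeasure ℝ) (Q : ProbabilityMeasure ℝ),
      (∀ ρ : ℝ, 0 < |ρ| → |ρ| < 1 →
        ∀ x : ℝ, cdf (P ρ : Measure ℝ) x = weakStrongEnvelope ρ x) ∧
      (∀ x : ℝ, cdf (Q : Measure ℝ) x = weakWeakEnvelope x) ∧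
      (Q : Measure ℝ) = negChiSquareMixture ∧
      Tendsto P (𝓝[≠] (0 : ℝ)) (𝓝 Q) ∧
      ContinuousAt (Function.update P 0 Q) 0 := by
  classical
  let Q : ProbabilityMeasure ℝ := ⟨negChiSquareMixture, inferInstance⟩
  -- Outside `0 < |ρ| < 1` the value of `P` is arbitrary, which the punctured limit at `0` ignores.
  choose! P hP using fun (ρ : ℝ) (h : 0 < |ρ| ∧ |ρ| < 1) =>
    WeakIdentificationEnvelope.exists_cdf_eq_weakStrongEnvelope h.1 h.2
  have hlim : Tendsto P (𝓝[≠] (0 : ℝ)) (𝓝 Q) := by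
    refine WeakIdentificationEnvelope.tendsto_probabilityMeasure_of_tendsto_cdf fun x hx => ?_
    refine (WeakIdentificationEnvelope.tendsto_weakStrongEnvelope hx).congr' ?_
    filter_upwards [WeakIdentificationEnvelope.eventually_abs_pos_and_lt_one] with ρ hρ
    exact (hP ρ hρ x).symm
  exact ⟨P, Q, fun ρ h0 h1 => hP ρ ⟨h0, h1⟩,
    fun x => (WeakIdentificationEnvelope.weakWeakEnvelope_eq_cdf x).symm, rfl, hlim,
    continuousAt_update_same.2 hlim⟩
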